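/- An abstract $n$-polytope ($n\ge 0$) is a partially ordered set with a least and a greatest face and a strictly monotone rank function with range $\{-1,0,\dots,n\}$, such that: every flag (maximal chain) contains exactly $n+2$ faces; whenever $F<G$ have ranks $j-1$ and $j+1$ there are exactly two $j$-faces $H$ with $F<H<G$; and for all $F\le G$ the flag graph of the section $G/F=\{H: F\le H\le G\}$ is connected (two flags being joined when they differ in the face of exactly one rank). Facets are the faces of rank $n-1$; a facet $F$ is identified, as a polytope, with the section of all faces $\le F$. The polytope $\mathcal P$ is regular if its automorphism group $\Gamma(\mathcal P)$ is transitive on flags; if $\rho_j$ ($0\le j\le n-1$) is the automorphism taking a base flag to the flag that differs from it in just the face of rank $j$, then $\mathcal P$ has (Schläfli) type $\{p_1,\dots,p_{n-1}\}$, where $p_j\in\{2,3,\dots\}\cup\{\infty\}$ is the period of $\rho_{j-1}\rho_j$. **Lemma 3.1.** Let $\mathcal K$ be a regular $m$-polytope of type $\{p_1,\dots,p_{m-1}\}$, finite or infinite, with facet set $A$. Then there is a regular $(m+1)$-polytope $\bar{\mathcal K}$ of type $\{p_1,\dots,p_{m-1},4\}$ (for $m=0$ both types are empty) such that: 1. every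 facet of $\bar{\mathcal K}$ is isomorphic to $\mathcal K$; 2. $\Gamma(\bar{\mathcal K})$ is isomorphic to the semidirect product $N\rtimes\Gamma(\mathcal K)$, where $N$ is the group of all finitely supported sequences $A\to C_2$ under componentwise multiplication (so $N=C_2^A$ when $A$ is finite), and $\Gamma(\mathcal K)$ acts on $N$ by permuting the coordinates as it permutes the facets of $\mathcal K$; 3. if $\mathcal K$ is finite, then $|\Gamma(\bar{\mathcal K})|=|\Gamma(\mathcal K)|\cdot 2^{|A|}$; 4. $\bar{\mathcal K}$ is finite if and only if $\mathcal K$ is finite. -/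

import Mathlib

universe u

namespace AbsPoly

/-- Two flags (maximal chains) of a ranked poset are `j`-adjacent if they are distinct and have
the same faces in every rank other than `j`. -/
def FlagAdj {P : Type u} [PartialOrder P] (rk : P → ℤ) (j : ℤ) (Φ Ψ : Flag P) : Prop :=
  Φ ≠ Ψ ∧ ∀ F : P, rk F ≠ j → (F ∈ Φ ↔ F ∈ Ψ)

/-- The flag graph: two flags are joined when they are `j`-adjacent for some rank `j`. -/
def flagGraph {P : Type u} [PartialOrder P] (rk : P → ℤ) : SimpleGraph (Flag P) where
  Adj Φ Ψ := ∃ j : ℤ, FlagAdj rk j Φ Ψ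
  symm := ⟨fun _ _ ⟨j, h⟩ => ⟨j, h.1.symm, fun F hF => (h.2 F hF).symm⟩⟩
  loopless := ⟨fun _ ⟨_, h⟩ => h.1 rfl⟩

/-- `P`, with least face `⊥`, greatest face `⊤` and rank function `rk`, is an abstract
`n`-polytope. -/
structure IsPolytope {P : Type u} [PartialOrder P] [BoundedOrder P] (n : ℕ) (rk : P → ℤ) :
    Prop where
  rank_strictMono : StrictMono rk
  rank_range : Set.range rk = Set.Icc (-1 : ℤ) n
  flag_card : ∀ Φ : Flag P, (Φ : Set P).encard = n + 2
  /-- the diamond condition -/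
  diamond : ∀ (F G : P) (j : ℤ), F < G → rk F = j - 1 → rk G = j + 1 →
    {H : P | rk H = j ∧ F < H ∧ H < G}.encard = 2
  /-- strong flag-connectedness: the flag graph of each section `G/F` is connected -/
  connected : ∀ F G : P, F ≤ G →
    (flagGraph (fun H : Set.Icc F G => rk H.1)).Connected

/-- An abstract `n`-polytope is regular if its automorphism group `P ≃o P` is transitive on the
set of flags. -/
structure IsRegularPolytope {P : Type u} [PartialOrder P] [BoundedOrder P] (n : ℕ) (rk : P → ℤ) :
    Prop extends IsPolytope n rk where
  flag_transitive : ∀ Φ Ψ : Flag P, ∃ σ : P ≃o P, σ • Φ = Ψ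

/-- The period (order) of a group element, `⊤` meaning infinite period. -/
noncomputable def period {G : Type u} [Group G] (g : G) : ℕ∞ :=
  if orderOf g = 0 then ⊤ else (orderOf g : ℕ∞)

/-- The (regular) `n`-polytope `P` has Schläfli type `{p 1, …, p (n - 1)}`: for some base flag `Φ`
and automorphisms `ρ 0, …, ρ (n - 1)` taking `Φ` to its adjacent flags, the period of
`ρ (j - 1) * ρ j` is `p j` for `1 ≤ j ≤ n - 1`. Other values of `p` and `ρ` are irrelevant. -/
def HasSchlafliType {P : Type u} [PartialOrder P] (n : ℕ) (rk : P → ℤ) (p : ℕ → ℕ∞) : Prop :=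
  ∃ (Φ : Flag P) (ρ : ℕ → (P ≃o P)),
    (∀ j : ℕ, j < n → FlagAdj rk j Φ (ρ j • Φ)) ∧
    ∀ j : ℕ, 1 ≤ j → j < n → period (ρ (j - 1) * ρ j) = p j

/-- The facets of an `n`-polytope are its faces of rank `n - 1`. -/
abbrev Facet {P : Type u} (n : ℕ) (rk : P → ℤ) : Type u :=
  {F : P // rk F = (n : ℤ) - 1}

section

variable {P : Type u} [PartialOrder P] [BoundedOrder P] {n : ℕ} {rk : P → ℤ}

theorem IsPolytope.rank_le (h : IsPolytope n rk) (F : P) : rk F ≤ n := by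
  have : rk F ∈ Set.Icc (-1 : ℤ) n := h.rank_range ▸ Set.mem_range_self F
  exact this.2

theorem IsPolytope.neg_one_le_rank (h : IsPolytope n rk) (F : P) : -1 ≤ rk F := by
  have : rk F ∈ Set.Icc (-1 : ℤ) n := h.rank_range ▸ Set.mem_range_self F
  exact this.1

theorem IsPolytope.rank_top (h : IsPolytope n rk) : rk ⊤ = n := by
  have : (n : ℤ) ∈ Set.range rk := by rw [h.rank_range]; constructor <;> omega
  obtain ⟨F, hF⟩ := this
  have := h.rank_strictMono.monotone (le_top : F ≤ ⊤)
  have := h.rank_le (⊤ : P)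
  omega

/-- Every flag contains a face of each rank. -/
theorem IsPolytope.exists_mem_flag (h : IsPolytope n rk) (Φ : Flag P) {j : ℤ}
    (h1 : -1 ≤ j) (h2 : j ≤ n) : ∃ F ∈ Φ, rk F = j := by
  have hinj : Set.InjOn rk (Φ : Set P) := by
    intro a ha b hb hab
    rcases Φ.le_or_le ha hb with hl | hl
    · by_contra hne
      exact absurd hab (h.rank_strictMono (lt_of_le_of_ne hl hne)).ne
    · by_contra hne
      exact absurd hab.symm (h.rank_strictMono (lt_of_le_of_ne hl (Ne.symm hne))).ne
  have hsub : rk '' (Φ : Set P) ⊆ Set.Icc (-1 : ℤ) n := by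
    rw [← h.rank_range]; exact Set.image_subset_range _ _
  have hcard : (rk '' (Φ : Set P)).encard = n + 2 := by
    rw [hinj.encard_image, h.flag_card]
  have hIcc : (Set.Icc (-1 : ℤ) n).encard = n + 2 := by
    rw [← Finset.coe_Icc, Set.encard_coe_eq_coe_finsetCard, Int.card_Icc]
    have : ((n : ℤ) + 1 - -1).toNat = n + 2 := by omega
    rw [this]; push_cast; rfl
  have heq : rk '' (Φ : Set P) = Set.Icc (-1 : ℤ) n :=
    (Set.finite_Icc _ _).eq_of_subset_of_encard_le' hsub (by rw [hcard, hIcc])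
  have : j ∈ rk '' (Φ : Set P) := by rw [heq]; exact ⟨h1, h2⟩
  obtain ⟨F, hF, hj⟩ := this
  exact ⟨F, hF, hj⟩

/-- The facets are exactly the coatoms. -/
theorem IsPolytope.facet_iff_isCoatom (h : IsPolytope n rk) (F : P) :
    rk F = (n : ℤ) - 1 ↔ IsCoatom F := by
  have htop := h.rank_top
  constructor
  · intro hF
    refine ⟨fun h0 => by rw [h0] at hF; omega, fun G hG => ?_⟩
    by_contra hne
    have h1 := h.rank_strictMono hG
    have h2 := h.rank_strictMono (lt_top_iff_ne_top.2 hne)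
    omega
  · intro hF
    obtain ⟨Φ, hΦ⟩ := Flag.exists_mem F
    obtain ⟨G, hG, hr⟩ := h.exists_mem_flag Φ (j := (n : ℤ) - 1) (by omega) (by omega)
    have hGtop : G ≠ ⊤ := fun h0 => by rw [h0] at hr; omega
    rcases Φ.le_or_le hΦ hG with hl | hl
    · rcases hl.eq_or_lt with he | hlt
      · rw [he, hr]
      · exact absurd (hF.2 G hlt) hGtop
    · rcases hl.eq_or_lt with he | hlt
      · rw [← he, hr]
      · have h1 := h.rank_strictMono hlt
        have h2 := h.rank_strictMono (lt_top_iff_ne_top.2 hF.1)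
        omega

theorem IsPolytope.facet_map_iff (h : IsPolytope n rk) (σ : P ≃o P) (F : P) :
    rk F = (n : ℤ) - 1 ↔ rk (σ F) = (n : ℤ) - 1 := by
  rw [h.facet_iff_isCoatom, h.facet_iff_isCoatom]
  exact (σ.isCoatom_iff F).symm

/-- The permutation action of the automorphism group on the set of facets. -/
def IsPolytope.facetPerm (h : IsPolytope n rk) : (P ≃o P) →* Equiv.Perm (Facet n rk) where
  toFun σ := σ.toEquiv.subtypeEquiv (h.facet_map_iff σ)
  map_one' := by ext; rfl
  map_mul' _ _ := by ext; rfl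

end

/-- The group of finitely supported sequences `x : A → C₂`, with componentwise operation. Here
`C₂` is the additive group `ZMod 2`, written multiplicatively. It is all of `C₂ ^ A` when `A` is
finite. -/
abbrev C2Pow (A : Type u) : Type u := Multiplicative (A →₀ ZMod 2)

/-- The action of the permutations of `A` on the sequences: `(π x)(F) = x (π⁻¹ F)`. -/
noncomputable def permC2Pow (A : Type u) : Equiv.Perm A →* MulAut (C2Pow A) where
  toFun π := AddEquiv.toMultiplicative (Finsupp.domCongr π)
  map_one' := by ext x; rfl
  map_mul' _ _ := by ext x; rfl

/-- The action of the automorphism group of a polytope on `C₂ ^ A`, where `A` is the set of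
facets. -/
noncomputable def IsPolytope.facetAction {P : Type u} [PartialOrder P] [BoundedOrder P] {n : ℕ}
    {rk : P → ℤ} (h : IsPolytope n rk) : (P ≃o P) →* MulAut (C2Pow (Facet n rk)) :=
  (permC2Pow (Facet n rk)).comp h.facetPerm

end AbsPoly

/-!
Take one copy of `K` for each finitely supported sequence `x : A → ZMod 2`, where `A` is the set
of facets of `K`, and glue the copies `x` and `y` along the face `F` whenever `x` and `y` differ
only at facets containing `F`; then add a greatest face. The copies of `K` are the facets, and two
of them meet in the facet `a` of `K` just when their sequences differ only at `a`. Hence the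
sections above a proper face are connected by changing one coordinate at a time. The group
`N ⋊ Γ(K)` acts by translating the sequences and by permuting their coordinates along with the
faces of `K`. This is the whole automorphism group: an automorphism carries the copy `0` to some
copy `y`, so it agrees on that copy with an element of `N ⋊ Γ(K)`, and an automorphism of a
polytope that fixes a flag is trivial. The last entry of the type is `4` because the commutator of
the flip at the base facet `a` with the last generator `ρ` of `Γ(K)` flips the two different
coordinates `a` and `ρ a`, and so has order `2`.
-/

namespace AbsPoly

section Flags

variable {S X : Type*} [PartialOrder S] [PartialOrder X]

theorem flag_eq_of_le {Φ Ψ : Flag X} (h : Φ ≤ Ψ) : Φ = Ψ :=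
  SetLike.coe_injective (Φ.maxChain.2 Ψ.chain_le h)

theorem isMaxChain_of_mem_iff {C : Set X} (h : ∀ a, a ∈ C ↔ ∀ b ∈ C, a ≤ b ∨ b ≤ a) :
    IsMaxChain (· ≤ ·) C :=
  ⟨fun a ha b hb _ => (h a).1 ha b hb, fun _ hs hCs => hCs.antisymm fun a ha =>
    (h a).2 fun _ hb => hs.total ha (hCs hb)⟩

theorem le_isCoatom_of_comparable [OrderTop X] {c t : X} (hc : IsCoatom c) (ht : t ≠ ⊤)
    (h : t ≤ c ∨ c ≤ t) : t ≤ c :=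
  h.elim id fun hct => (hc.le_iff_eq ht).1 hct |>.le

/-- An order embedding of `S` as the set of all elements below some coatom of `X`; for the face
poset `X` of a polytope this identifies `S` with a facet of `X`. -/
structure IsFacetEmbedding [OrderTop S] [OrderTop X] (φ : S ↪o X) : Prop where
  isCoatom_top : IsCoatom (φ ⊤)
  isLowerSet_range : IsLowerSet (Set.range φ)

variable [OrderTop S] [OrderTop X] {φ : S ↪o X}

namespace IsFacetEmbedding

theorem ne_top (hφ : IsFacetEmbedding φ) (s : S) : φ s ≠ ⊤ := fun h =>
  hφ.isCoatom_top.1 (top_le_iff.1 (h ▸ φ.monotone le_top))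

theorem range_eq (hφ : IsFacetEmbedding φ) : Set.range φ = Set.Iic (φ ⊤) :=
  Set.Subset.antisymm (Set.range_subset_iff.2 fun _ => φ.monotone le_top)
    fun _ ht => hφ.isLowerSet_range ht ⟨⊤, rfl⟩

theorem exists_of_mem_flag (hφ : IsFacetEmbedding φ) {Θ : Flag X} (hΘ : φ ⊤ ∈ Θ) {t : X}
    (ht : t ∈ Θ) (hne : t ≠ ⊤) : ∃ s, φ s = t :=
  hφ.isLowerSet_range (le_isCoatom_of_comparable hφ.isCoatom_top hne (Θ.le_or_le ht hΘ)) ⟨⊤, rfl⟩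

theorem isMaxChain_insert_top_image (hφ : IsFacetEmbedding φ) (Ψ : Flag S) :
    IsMaxChain (· ≤ ·) (insert ⊤ (φ '' (Ψ : Set S))) := by
  refine isMaxChain_of_mem_iff fun a => ⟨?_, fun h => or_iff_not_imp_left.2 fun ha => ?_⟩
  · rintro (rfl | ⟨s, hs, rfl⟩) b (rfl | ⟨t, ht, rfl⟩)
    any_goals simp only [le_top, true_or, or_true]
    simpa only [φ.le_iff_le] using Ψ.le_or_le hs ht
  · obtain ⟨s, rfl⟩ := hφ.isLowerSet_range (le_isCoatom_of_comparable hφ.isCoatom_top ha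
      (h _ (Or.inr ⟨⊤, Ψ.top_mem, rfl⟩))) ⟨⊤, rfl⟩
    refine ⟨s, Flag.mem_iff_forall_le_or_ge.2 fun b hb => ?_, rfl⟩
    simpa only [φ.le_iff_le] using h (φ b) (Or.inr ⟨b, hb, rfl⟩)

/-- The flag of `X` obtained from a flag of the facet `S` by adding the greatest element. -/
def extendFlag (hφ : IsFacetEmbedding φ) (Ψ : Flag S) : Flag X :=
  Flag.ofIsMaxChain _ (hφ.isMaxChain_insert_top_image Ψ)

theorem mem_extendFlag (hφ : IsFacetEmbedding φ) {Ψ : Flag S} {a : X} :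
    a ∈ hφ.extendFlag Ψ ↔ a = ⊤ ∨ ∃ s ∈ Ψ, φ s = a :=
  Iff.rfl

theorem map_mem_extendFlag (hφ : IsFacetEmbedding φ) {Ψ : Flag S} {s : S} :
    φ s ∈ hφ.extendFlag Ψ ↔ s ∈ Ψ := by
  simp only [hφ.mem_extendFlag, hφ.ne_top, false_or, φ.injective.eq_iff, exists_eq_right]

theorem extendFlag_injective (hφ : IsFacetEmbedding φ) : Function.Injective hφ.extendFlag :=
  fun _ _ h => SetLike.ext fun s => by rw [← hφ.map_mem_extendFlag, h, hφ.map_mem_extendFlag]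

theorem encard_extendFlag (hφ : IsFacetEmbedding φ) (Ψ : Flag S) :
    (hφ.extendFlag Ψ : Set X).encard = (Ψ : Set S).encard + 1 := by
  rw [show (hφ.extendFlag Ψ : Set X) = insert ⊤ (φ '' (Ψ : Set S)) from rfl,
    Set.encard_insert_of_notMem, φ.injective.encard_image]
  rintro ⟨s, -, hs⟩
  exact hφ.ne_top s hs

theorem exists_extendFlag_eq (hφ : IsFacetEmbedding φ) {Θ : Flag X} (hΘ : φ ⊤ ∈ Θ) :
    ∃ Ψ, hφ.extendFlag Ψ = Θ := by
  have hchain : IsMaxChain (· ≤ ·) (φ ⁻¹' (Θ : Set X)) := isMaxChain_of_mem_iff fun a => by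
    refine ⟨fun ha b hb => by simpa only [φ.le_iff_le] using Θ.le_or_le ha hb, fun h =>
      Flag.mem_iff_forall_le_or_ge.2 fun b hb => ?_⟩
    rcases eq_or_ne b ⊤ with rfl | hbt
    · exact Or.inl le_top
    · obtain ⟨s, rfl⟩ := hφ.exists_of_mem_flag hΘ hb hbt
      simpa only [φ.le_iff_le] using h s hb
  refine ⟨Flag.ofIsMaxChain _ hchain, (flag_eq_of_le fun t ht => ?_).symm⟩
  rcases eq_or_ne t ⊤ with rfl | htt
  · exact Flag.top_mem _
  · obtain ⟨s, rfl⟩ := hφ.exists_of_mem_flag hΘ ht htt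
    exact hφ.map_mem_extendFlag.2 ht

/-- The elements below the coatom form a copy of `S`. -/
noncomputable def iicIso (hφ : IsFacetEmbedding φ) : S ≃o Set.Iic (φ ⊤) :=
  OrderEmbedding.orderIso.trans (OrderIso.setCongr _ _ hφ.range_eq)

theorem exists_orderIso_of_map_top {ψ : S ↪o X} (hφ : IsFacetEmbedding φ)
    (hψ : IsFacetEmbedding ψ) {τ : X ≃o X} (h : τ (φ ⊤) = ψ ⊤) :
    ∃ σ : S ≃o S, ∀ s, ψ (σ s) = τ (φ s) := by
  have hrange : Set.range (φ.trans τ.toOrderEmbedding) = Set.range ψ := by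
    rw [hψ.range_eq, ← h, ← τ.image_Iic, ← hφ.range_eq, ← Set.range_comp]
    rfl
  exact ⟨OrderEmbedding.orderIso.trans
      ((OrderIso.setCongr _ _ hrange).trans ψ.orderIso.symm),
    fun s => congrArg Subtype.val (ψ.orderIso.apply_symm_apply _)⟩

end IsFacetEmbedding

end Flags

section Sections

variable {S X : Type*} [PartialOrder S] [PartialOrder X]

/-- An order embedding maps the elements above `F` to the elements above the image `t` of `F`. -/
def iciEmbedding (φ : S ↪o X) {F : S} {t : X} (h : φ F = t) : Set.Ici F ↪o Set.Ici t :=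
  OrderEmbedding.ofMapLEIff (fun s => ⟨φ s, h ▸ φ.monotone s.2⟩) fun _ _ => φ.le_iff_le

variable [OrderTop S] [OrderTop X] {φ : S ↪o X}

theorem IsFacetEmbedding.iciEmbedding (hφ : IsFacetEmbedding φ) {F : S} {t : X} (h : φ F = t) :
    IsFacetEmbedding (iciEmbedding φ h) where
  isCoatom_top := hφ.isCoatom_top.Ici (h ▸ φ.monotone le_top)
  isLowerSet_range := by
    rintro _ ⟨b, hb⟩ hba ⟨s, rfl⟩
    obtain ⟨s', rfl⟩ := hφ.isLowerSet_range (show b ≤ φ s from hba) ⟨_, rfl⟩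
    exact ⟨⟨s', φ.le_iff_le.1 (h.trans_le hb)⟩, rfl⟩

/-- Facet embeddings identify sections. -/
noncomputable def IsFacetEmbedding.sectionIso (hφ : IsFacetEmbedding φ) (F G : S) :
    Set.Icc F G ≃o Set.Icc (φ F) (φ G) :=
  RelIso.ofSurjective
    (OrderEmbedding.ofMapLEIff (fun s : Set.Icc F G =>
      (⟨φ s, φ.monotone s.2.1, φ.monotone s.2.2⟩ : Set.Icc (φ F) (φ G))) fun _ _ => φ.le_iff_le)
    fun ⟨t, ht⟩ => by
      obtain ⟨s, rfl⟩ := hφ.isLowerSet_range ht.2 ⟨G, rfl⟩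
      exact ⟨⟨s, φ.le_iff_le.1 ht.1, φ.le_iff_le.1 ht.2⟩, rfl⟩

end Sections

section FlagGraph

variable {P Q : Type*} [PartialOrder P] [PartialOrder Q]

theorem mem_flag_map_iff (e : P ≃o Q) {Φ : Flag P} {F : Q} :
    F ∈ Flag.map e Φ ↔ e.symm F ∈ Φ := by
  rw [← SetLike.mem_coe, Flag.coe_map, e.image_eq_preimage_symm]
  rfl

theorem flagAdj_map_iff (e : P ≃o Q) {r : P → ℤ} {r' : Q → ℤ} (hr : ∀ F, r' (e F) = r F) {j : ℤ}
    {Φ Ψ : Flag P} : FlagAdj r' j (Flag.map e Φ) (Flag.map e Ψ) ↔ FlagAdj r j Φ Ψ := by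
  simp only [FlagAdj, ne_eq, (Flag.map e).injective.eq_iff, mem_flag_map_iff,
    e.surjective.forall, hr, e.symm_apply_apply]

theorem flagGraph_connected_congr (e : P ≃o Q) {r : P → ℤ} {r' : Q → ℤ}
    (hr : ∀ F, r' (e F) = r F) : (flagGraph r).Connected ↔ (flagGraph r').Connected :=
  SimpleGraph.Iso.connected_iff
    ⟨Flag.map e, exists_congr fun _ => flagAdj_map_iff e hr⟩

theorem flagGraph_connected_of_subsingleton [Subsingleton P] (r : P → ℤ) :
    (flagGraph r).Connected := by
  have : Subsingleton (Flag P) := ⟨fun Φ Ψ => flag_eq_of_le fun F _ =>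
    Flag.mem_iff_forall_le_or_ge.2 fun G _ => Or.inl (Subsingleton.elim F G).le⟩
  exact SimpleGraph.Connected.of_subsingleton

variable {S X : Type*} [PartialOrder S] [PartialOrder X] [OrderTop S] [OrderTop X]
  {r : X → ℤ} {r' : S → ℤ} {j : ℤ}

theorem FlagAdj.extendFlag {φ : S ↪o X} (hφ : IsFacetEmbedding φ) (hr : ∀ s, r (φ s) = r' s)
    {Ψ Ψ' : Flag S} (h : FlagAdj r' j Ψ Ψ') :
    FlagAdj r j (hφ.extendFlag Ψ) (hφ.extendFlag Ψ') := by
  refine ⟨hφ.extendFlag_injective.ne h.1, fun F hF => ?_⟩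
  rw [hφ.mem_extendFlag, hφ.mem_extendFlag]
  refine or_congr_right (exists_congr fun s => and_congr_left ?_)
  rintro rfl
  exact h.2 s (hr s ▸ hF)

theorem flagAdj_extendFlag_of_agree {φ φ' : S ↪o X} (hφ : IsFacetEmbedding φ)
    (hφ' : IsFacetEmbedding φ') (hj : r (φ ⊤) = j) (hj' : r (φ' ⊤) = j) (hne : φ ⊤ ≠ φ' ⊤)
    {Ψ : Flag S} (hagree : ∀ s ∈ Ψ, s ≠ ⊤ → φ s = φ' s) :
    FlagAdj r j (hφ.extendFlag Ψ) (hφ'.extendFlag Ψ) := by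
  refine ⟨fun he => ?_, fun F hF => ?_⟩
  · obtain h | ⟨s, -, hs⟩ : φ ⊤ ∈ hφ'.extendFlag Ψ := he ▸ hφ.map_mem_extendFlag.2 Ψ.top_mem
    · exact hφ.ne_top _ h
    · have hle : φ ⊤ ≤ φ' ⊤ := hs ▸ φ'.monotone le_top
      exact hne (((hφ.isCoatom_top.le_iff_eq (hφ'.ne_top _)).1 hle).symm)
  · rw [hφ.mem_extendFlag, hφ'.mem_extendFlag]
    refine or_congr_right (exists_congr fun s => and_congr_right fun hs => ?_)
    rcases eq_or_ne s ⊤ with rfl | hst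
    · exact iff_of_false (fun h => hF (h ▸ hj)) fun h => hF (h ▸ hj')
    · rw [hagree s hs hst]

variable {ι : Type*} {φ : ι → S ↪o X}

theorem exists_extendFlag_eq_of_cover [WellFoundedGT X] [Nontrivial X]
    (hφ : ∀ i, IsFacetEmbedding (φ i)) (hcover : ∀ t ≠ ⊤, ∃ i s, φ i s = t) (Θ : Flag X) :
    ∃ i Ψ, (hφ i).extendFlag Ψ = Θ := by
  have hne : {t ∈ (Θ : Set X) | t ≠ ⊤}.Nonempty := by
    by_contra! hempty
    have hΘ : ∀ b ∈ Θ, b = ⊤ := fun b hb => by_contra fun h => hempty.subset ⟨hb, h⟩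
    obtain ⟨t, ht⟩ := exists_ne (⊤ : X)
    exact ht (hΘ t (Flag.mem_iff_forall_le_or_ge.2 fun b hb => Or.inl (hΘ b hb ▸ le_top)))
  obtain ⟨c, ⟨hc, hct⟩, hmax⟩ := (wellFounded_gt (α := X)).has_min _ hne
  obtain ⟨i, s, rfl⟩ := hcover c hct
  refine ⟨i, (hφ i).exists_extendFlag_eq (Flag.mem_iff_forall_le_or_ge.2 fun b hb => ?_)⟩
  rcases eq_or_ne b ⊤ with rfl | hbt
  · exact Or.inl le_top
  · have hbs : b ≤ φ i s :=
      (Θ.le_or_le hb hc).elim id fun h => (eq_of_le_of_not_lt h (hmax b ⟨hb, hbt⟩)).ge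
    exact Or.inr (hbs.trans ((φ i).monotone le_top))

theorem flagGraph_connected_of_cover [WellFoundedGT X] [Nontrivial X]
    (hφ : ∀ i, IsFacetEmbedding (φ i)) (hcover : ∀ t ≠ ⊤, ∃ i s, φ i s = t)
    (hr : ∀ i s, r (φ i s) = r' s) (hS : (flagGraph r').Connected)
    (hlink : ∀ i i', Relation.ReflTransGen
      (fun i i' => ∃ Ψ j, FlagAdj r j ((hφ i).extendFlag Ψ) ((hφ i').extendFlag Ψ)) i i') :
    (flagGraph r).Connected := by
  have hfacet : ∀ i Ψ Ψ',
      (flagGraph r).Reachable ((hφ i).extendFlag Ψ) ((hφ i).extendFlag Ψ') := fun i Ψ Ψ' =>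
    (hS.preconnected Ψ Ψ').map
      (⟨(hφ i).extendFlag, fun ⟨j, hj⟩ => ⟨j, hj.extendFlag (hφ i) (hr i)⟩⟩ :
        flagGraph r' →g flagGraph r)
  have hall : ∀ i i' Ψ Ψ',
      (flagGraph r).Reachable ((hφ i).extendFlag Ψ) ((hφ i').extendFlag Ψ') := by
    intro i i' Ψ
    induction hlink i i' with
    | refl => exact hfacet i Ψ
    | tail _ h ih =>
      obtain ⟨Ψ₀, j, hj⟩ := h
      exact fun Ψ' => ((ih Ψ₀).trans (SimpleGraph.Adj.reachable ⟨j, hj⟩)).trans (hfacet _ Ψ₀ Ψ')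
  have : Nonempty (Flag X) := inferInstance
  refine ⟨fun Θ Θ' => ?_⟩
  obtain ⟨i, Ψ, rfl⟩ := exists_extendFlag_eq_of_cover hφ hcover Θ
  obtain ⟨i', Ψ', rfl⟩ := exists_extendFlag_eq_of_cover hφ hcover Θ'
  exact hall i i' Ψ Ψ'

theorem wellFoundedGT_of_strictMono_of_le {f : P → ℤ} (hf : StrictMono f) {N : ℤ}
    (hN : ∀ F, f F ≤ N) : WellFoundedGT P :=
  StrictAnti.wellFoundedGT (f := fun F => (N - f F).toNat) fun F G h => by
    have := hf h
    have := hN G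
    dsimp only
    omega

end FlagGraph

section Rigidity

variable {P : Type u} [PartialOrder P] {n : ℕ} {rk : P → ℤ} {j : ℤ} {Φ Ψ Ψ' : Flag P}

theorem FlagAdj.symm (h : FlagAdj rk j Φ Ψ) : FlagAdj rk j Ψ Φ :=
  ⟨h.1.symm, fun F hF => (h.2 F hF).symm⟩

theorem FlagAdj.exists_mem_notMem (h : FlagAdj rk j Φ Ψ) : ∃ F ∈ Φ, F ∉ Ψ ∧ rk F = j := by
  by_contra! hΦ
  exact h.1 (flag_eq_of_le fun F hF => by_contra fun hFΨ => hFΨ ((h.2 F (hΦ F hF hFΨ)).1 hF))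

theorem mem_flag_smul_iff {σ : P ≃o P} {F : P} : F ∈ σ • Φ ↔ σ.symm F ∈ Φ :=
  mem_flag_map_iff σ

variable [BoundedOrder P]

namespace IsPolytope

theorem rank_bot (h : IsPolytope n rk) : rk ⊥ = -1 := by
  obtain ⟨F, hF⟩ : (-1 : ℤ) ∈ Set.range rk := h.rank_range ▸ ⟨le_rfl, by omega⟩
  have := h.rank_strictMono.monotone (bot_le : ⊥ ≤ F)
  have := h.neg_one_le_rank ⊥
  omega

theorem eq_of_mem_flag (h : IsPolytope n rk) {F G : P} (hF : F ∈ Φ) (hG : G ∈ Φ)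
    (hr : rk F = rk G) : F = G :=
  (Φ.le_or_le hF hG).elim
    (fun hle => eq_of_le_of_not_lt hle fun hlt => (h.rank_strictMono hlt).ne hr)
    fun hle => (eq_of_le_of_not_lt hle fun hlt => (h.rank_strictMono hlt).ne' hr).symm

theorem lt_of_mem_flag (h : IsPolytope n rk) {F G : P} (hF : F ∈ Φ) (hG : G ∈ Φ)
    (hr : rk F < rk G) : F < G :=
  (Φ.le_or_le hF hG).elim (fun hle => hle.lt_of_ne fun he => hr.ne (congrArg rk he))
    fun hle => absurd (h.rank_strictMono.monotone hle) hr.not_ge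

theorem rank_le_of_strictMono (h : IsPolytope n rk) {f : P → ℤ} (hf : StrictMono f)
    (hf' : ∀ F, -1 ≤ f F) (F : P) : rk F ≤ f F := by
  obtain ⟨k, hk⟩ : ∃ k : ℕ, rk F = k - 1 :=
    ⟨(rk F + 1).toNat, by have := h.neg_one_le_rank F; omega⟩
  induction k generalizing F with
  | zero =>
    have := hf' F
    omega
  | succ k ih =>
    obtain ⟨Φ, hΦ⟩ := Flag.exists_mem F
    obtain ⟨G, hG, hr⟩ := h.exists_mem_flag Φ (j := (k : ℤ) - 1) (by omega)
      (by have := h.rank_le F; omega)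
    have := ih G hr
    have := hf (h.lt_of_mem_flag hG hΦ (by omega))
    omega

theorem rank_map (h : IsPolytope n rk) (σ : P ≃o P) (F : P) : rk (σ F) = rk F := by
  refine le_antisymm ?_ (h.rank_le_of_strictMono (h.rank_strictMono.comp σ.strictMono)
    (fun G => h.neg_one_le_rank _) F)
  simpa using h.rank_le_of_strictMono (h.rank_strictMono.comp σ.symm.strictMono)
    (fun G => h.neg_one_le_rank _) (σ F)

theorem flagAdj_smul_iff (h : IsPolytope n rk) (σ : P ≃o P) :
    FlagAdj rk j (σ • Φ) (σ • Ψ) ↔ FlagAdj rk j Φ Ψ :=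
  flagAdj_map_iff σ (h.rank_map σ)

theorem notMem_of_flagAdj (h : IsPolytope n rk) (hadj : FlagAdj rk j Φ Ψ) {F : P} (hF : F ∈ Φ)
    (hj : rk F = j) : F ∉ Ψ := by
  obtain ⟨G, hG, hGΨ, hr⟩ := hadj.exists_mem_notMem
  rwa [h.eq_of_mem_flag hF hG (hj.trans hr.symm)]

/-- The faces of rank `j` of the three flags are among the two faces of a diamond. -/
theorem flagAdj_unique (h : IsPolytope n rk) (hΨ : FlagAdj rk j Φ Ψ)
    (hΨ' : FlagAdj rk j Φ Ψ') : Ψ = Ψ' := by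
  obtain ⟨H, hH, hHΨ, rH⟩ := hΨ.exists_mem_notMem
  obtain ⟨H₁, hH₁, hH₁Φ, rH₁⟩ := hΨ.symm.exists_mem_notMem
  obtain ⟨H₂, hH₂, hH₂Φ, rH₂⟩ := hΨ'.symm.exists_mem_notMem
  have hbot : rk ⊥ < rk H :=
    h.rank_strictMono (bot_lt_iff_ne_bot.2 fun hb => hHΨ (hb ▸ Ψ.bot_mem))
  have htop : rk H < rk ⊤ :=
    h.rank_strictMono (lt_top_iff_ne_top.2 fun ht => hHΨ (ht ▸ Ψ.top_mem))
  rw [h.rank_bot] at hbot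
  rw [h.rank_top] at htop
  obtain ⟨A, hA, rA⟩ := h.exists_mem_flag Φ (j := j - 1) (by omega) (by omega)
  obtain ⟨B, hB, rB⟩ := h.exists_mem_flag Φ (j := j + 1) (by omega) (by omega)
  have between : ∀ {Θ : Flag P} {G : P}, A ∈ Θ → B ∈ Θ → G ∈ Θ → rk G = j →
      G ∈ {H : P | rk H = j ∧ A < H ∧ H < B} := fun hA hB hG rG =>
    ⟨rG, h.lt_of_mem_flag hA hG (by omega), h.lt_of_mem_flag hG hB (by omega)⟩
  have hmem := between hA hB hH rH
  have hmem₁ := between ((hΨ.2 A (by omega)).1 hA) ((hΨ.2 B (by omega)).1 hB) hH₁ rH₁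
  have hmem₂ := between ((hΨ'.2 A (by omega)).1 hA) ((hΨ'.2 B (by omega)).1 hB) hH₂ rH₂
  have hH₁₂ : H₁ = H₂ := by
    obtain ⟨x, y, -, hxy⟩ := Set.encard_eq_two.1
      (h.diamond A B j (h.lt_of_mem_flag hA hB (by omega)) rA rB)
    simp only [hxy, Set.mem_insert_iff, Set.mem_singleton_iff] at hmem hmem₁ hmem₂
    grind
  refine flag_eq_of_le fun F hF => ?_
  by_cases hj : rk F = j
  · rwa [h.eq_of_mem_flag hF hH₁ (hj.trans rH₁.symm), hH₁₂]
  · exact (hΨ'.2 F hj).1 ((hΨ.2 F hj).2 hF)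

theorem flagGraph_connected (h : IsPolytope n rk) : (flagGraph rk).Connected :=
  (flagGraph_connected_congr ((OrderIso.setCongr _ _ Set.Icc_bot_top).trans OrderIso.Set.univ)
    fun _ => rfl).1 (h.connected ⊥ ⊤ bot_le)

theorem eq_one_of_smul_eq (h : IsPolytope n rk) {σ : P ≃o P} (hσ : σ • Φ = Φ) : σ = 1 := by
  have hall : ∀ Ψ : Flag P, σ • Ψ = Ψ := by
    intro Ψ
    obtain ⟨w⟩ := h.flagGraph_connected.preconnected Φ Ψ
    induction w with
    | nil => exact hσ
    | cons hadj _ ih =>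
      obtain ⟨j, hj⟩ := hadj
      refine ih (h.flagAdj_unique ?_ hj)
      simpa only [hσ] using (h.flagAdj_smul_iff σ).2 hj
  ext F
  obtain ⟨Ψ, hΨ⟩ := Flag.exists_mem F
  refine h.eq_of_mem_flag ?_ hΨ (h.rank_map σ F)
  rw [← hall Ψ, mem_flag_smul_iff, σ.symm_apply_apply]
  exact hΨ

theorem eq_of_smul_eq_smul (h : IsPolytope n rk) {σ τ : P ≃o P} (hστ : σ • Φ = τ • Φ) : σ = τ :=
  (inv_mul_eq_one.1 (h.eq_one_of_smul_eq (by rw [mul_smul, hστ, inv_smul_smul]))).symm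

theorem mul_self_eq_one_of_flagAdj (h : IsPolytope n rk) {σ : P ≃o P}
    (hadj : FlagAdj rk j Φ (σ • Φ)) : σ * σ = 1 :=
  h.eq_one_of_smul_eq (Φ := Φ) (by
    rw [mul_smul]
    exact h.flagAdj_unique ((h.flagAdj_smul_iff σ).2 hadj) hadj.symm)

theorem map_ne_of_flagAdj (h : IsPolytope n rk) {σ : P ≃o P} (hadj : FlagAdj rk j Φ (σ • Φ))
    {F : P} (hF : F ∈ Φ) (hj : rk F = j) : σ F ≠ F := fun he =>
  h.notMem_of_flagAdj hadj hF hj (mem_flag_smul_iff.2 (by rwa [σ.symm_apply_eq.2 he.symm]))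

end IsPolytope

end Rigidity

section Coordinates

variable {K : Type u} {n : ℕ} {rk : K → ℤ}

/-- The finitely supported sequences indexed by the facets, written additively; the group `N` of
the semidirect product is `Multiplicative (Coord n rk)`. -/
abbrev Coord (n : ℕ) (rk : K → ℤ) : Type u :=
  Facet n rk →₀ ZMod 2

/-- Two sequences lie in the same coset of the group of sequences supported on the facets that
contain `F`. -/
def AgreeOff [LE K] (F : K) (x y : Coord n rk) : Prop :=
  ∀ a : Facet n rk, ¬ F ≤ a.1 → x a = y a

namespace AgreeOff

theorem refl [LE K] (F : K) (x : Coord n rk) : AgreeOff F x x :=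
  fun _ _ => rfl

theorem symm [LE K] {F : K} {x y : Coord n rk} (h : AgreeOff F x y) : AgreeOff F y x :=
  fun a ha => (h a ha).symm

theorem trans [LE K] {F : K} {x y z : Coord n rk} (h : AgreeOff F x y) (h' : AgreeOff F y z) :
    AgreeOff F x z :=
  fun a ha => (h a ha).trans (h' a ha)

theorem mono [Preorder K] {F G : K} {x y : Coord n rk} (hFG : F ≤ G) (h : AgreeOff G x y) :
    AgreeOff F x y :=
  fun a ha => h a fun hGa => ha (hFG.trans hGa)

theorem add_single [LE K] {F : K} {a : Facet n rk} (ha : F ≤ a.1) (x : Coord n rk) (b : ZMod 2) :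
    AgreeOff F x (x + Finsupp.single a b) := fun c hc => by
  rw [Finsupp.add_apply, Finsupp.single_eq_of_ne (fun h : c = a => hc (h ▸ ha)), add_zero]

@[elab_as_elim]
theorem induction_on [LE K] {F : K} {x y : Coord n rk} {C : ∀ y, AgreeOff F x y → Prop}
    (h : AgreeOff F x y) (hx : C x (.refl F x))
    (hstep : ∀ z a (ha : F ≤ a.1) (hz : AgreeOff F x z), C z hz →
      C (z + Finsupp.single a 1) (hz.trans (.add_single ha z 1))) : C y h := by
  suffices H : ∀ d : Coord n rk, AgreeOff F 0 d → ∃ hd, C (x + d) hd by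
    have hd : AgreeOff F 0 (y - x) := fun a ha => by
      rw [Finsupp.sub_apply, h a ha, sub_self, Finsupp.zero_apply]
    simpa only [add_sub_cancel] using (H _ hd).2
  intro d
  induction d using Finsupp.induction with
  | zero => exact fun _ => (add_zero x).symm ▸ ⟨refl F x, hx⟩
  | single_add a b f haf hb ih =>
    intro hd
    obtain rfl : b = 1 := Fin.eq_one_of_ne_zero b hb
    have hFa : F ≤ a.1 := by
      by_contra ha
      simpa [Finsupp.notMem_support_iff.1 haf] using hd a ha
    obtain ⟨hf, hCf⟩ := ih (hd.trans (by
      rw [add_comm]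
      exact (add_single hFa f 1).symm))
    rw [add_comm (Finsupp.single a 1), ← add_assoc]
    exact ⟨_, hstep _ a hFa hf hCf⟩

end AgreeOff

end Coordinates

section Faces

variable {K : Type u} [PartialOrder K] {n : ℕ} {rk : K → ℤ}

/-- A representative of a proper face of the extension: the face `face` of `K`, in the copies of
`K` whose coordinates lie in the coset of `coord` given by `AgreeOff face`. -/
@[ext]
structure PreFace (n : ℕ) (rk : K → ℤ) : Type u where
  face : K
  coord : Coord n rk

instance : Preorder (PreFace n rk) where
  le p q := p.face ≤ q.face ∧ AgreeOff p.face p.coord q.coord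
  le_refl p := ⟨le_rfl, .refl _ _⟩
  le_trans _ _ _ h h' := ⟨h.1.trans h'.1, h.2.trans (h'.2.mono h.1)⟩

instance [OrderBot K] : OrderBot (Antisymmetrization (PreFace n rk) (· ≤ ·)) where
  bot := toAntisymmetrization _ ⟨⊥, 0⟩
  bot_le p := Quotient.inductionOn p fun _ => ⟨bot_le, fun _ ha => absurd bot_le ha⟩

/-- The face poset of the extension of `K`: the proper faces, given by `PreFace` up to equality of
faces and of cosets, and a greatest face. -/
abbrev Extension (n : ℕ) (rk : K → ℤ) : Type u :=
  WithTop (Antisymmetrization (PreFace n rk) (· ≤ ·))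

namespace Extension

/-- The rank function of the extension. -/
def rank : Extension n rk → ℤ :=
  WithTop.recTopCoe (n + 1) (Quotient.lift (fun p => rk p.face) fun _ _ h =>
    congrArg rk (le_antisymm h.1.1 h.2.1))

/-- The copy of `K` below the facet with coordinates `y`. -/
def facetEmb (y : Coord n rk) : K ↪o Extension n rk :=
  OrderEmbedding.ofMapLEIff
    (fun F => ((toAntisymmetrization (· ≤ ·) (PreFace.mk F y) : _) : Extension n rk))
    fun _ _ => WithTop.coe_le_coe.trans (and_iff_left (.refl _ y))

theorem rank_top : rank (⊤ : Extension n rk) = n + 1 :=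
  rfl

theorem facetEmb_le_facetEmb_iff {F G : K} {x y : Coord n rk} :
    facetEmb x F ≤ facetEmb y G ↔ F ≤ G ∧ AgreeOff F x y :=
  WithTop.coe_le_coe

theorem facetEmb_eq_facetEmb_iff {F G : K} {x y : Coord n rk} :
    facetEmb x F = facetEmb y G ↔ F = G ∧ AgreeOff F x y := by
  refine ⟨fun h => ?_, ?_⟩
  · have hle := facetEmb_le_facetEmb_iff.1 h.le
    exact ⟨le_antisymm hle.1 (facetEmb_le_facetEmb_iff.1 h.ge).1, hle.2⟩
  · rintro ⟨rfl, h⟩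
    exact le_antisymm (facetEmb_le_facetEmb_iff.2 ⟨le_rfl, h⟩)
      (facetEmb_le_facetEmb_iff.2 ⟨le_rfl, h.symm⟩)

theorem facetEmb_ne_top (y : Coord n rk) (F : K) : facetEmb y F ≠ ⊤ :=
  WithTop.coe_ne_top

theorem exists_facetEmb_eq {t : Extension n rk} (ht : t ≠ ⊤) : ∃ y F, facetEmb y F = t := by
  obtain ⟨p, rfl⟩ := WithTop.ne_top_iff_exists.1 ht
  induction p using Quotient.inductionOn with
  | h p => exact ⟨p.coord, p.face, rfl⟩

theorem isLowerSet_range_facetEmb (y : Coord n rk) :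
    IsLowerSet (Set.range (facetEmb y : K ↪o Extension n rk)) := by
  rintro _ t ht ⟨G, rfl⟩
  obtain ⟨x, F, rfl⟩ := exists_facetEmb_eq (ne_top_of_le_ne_top (facetEmb_ne_top y G) ht)
  exact ⟨F, facetEmb_eq_facetEmb_iff.2 ⟨rfl, (facetEmb_le_facetEmb_iff.1 ht).2.symm⟩⟩

theorem faces_between_facetEmb (y : Coord n rk) (F G : K) (j : ℤ) :
    {t : Extension n rk | rank t = j ∧ facetEmb y F < t ∧ t < facetEmb y G} =
      facetEmb y '' {H | rk H = j ∧ F < H ∧ H < G} := by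
  refine Set.Subset.antisymm ?_ ?_
  · rintro t ⟨hr, hFt, htG⟩
    obtain ⟨H, rfl⟩ := isLowerSet_range_facetEmb y htG.le ⟨G, rfl⟩
    exact ⟨H, ⟨hr, (facetEmb y).lt_iff_lt.1 hFt, (facetEmb y).lt_iff_lt.1 htG⟩, rfl⟩
  · rintro _ ⟨H, ⟨hr, hFH, hHG⟩, rfl⟩
    exact ⟨hr, (facetEmb y).lt_iff_lt.2 hFH, (facetEmb y).lt_iff_lt.2 hHG⟩

theorem finite_iff : Finite (Extension n rk) ↔ Finite K := by
  refine ⟨fun _ => Finite.of_injective _ (facetEmb (0 : Coord n rk)).injective, fun _ => ?_⟩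
  have : Finite (Coord n rk) := Finite.of_injective _ DFunLike.coe_injective
  have : Finite (PreFace n rk) := Finite.of_injective (fun p => (p.face, p.coord)) fun _ _ h =>
    PreFace.ext (congrArg Prod.fst h) (congrArg Prod.snd h)
  have : Finite (Antisymmetrization (PreFace n rk) (· ≤ ·)) := Quotient.finite _
  infer_instance

end Extension

end Faces

section Polytope

variable {K : Type u} [PartialOrder K] [BoundedOrder K] {n : ℕ} {rk : K → ℤ}

theorem IsPolytope.isCoatom_facet (hK : IsPolytope n rk) (a : Facet n rk) : IsCoatom a.1 :=
  (hK.facet_iff_isCoatom a.1).1 a.2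

theorem IsPolytope.facet_le_iff_eq (hK : IsPolytope n rk) {a b : Facet n rk} :
    a.1 ≤ b.1 ↔ a = b := by
  rw [Subtype.ext_iff, eq_comm, ← (hK.isCoatom_facet a).le_iff_eq (hK.isCoatom_facet b).1]

theorem agreeOff_top_iff (hK : IsPolytope n rk) {x y : Coord n rk} :
    AgreeOff (⊤ : K) x y ↔ x = y :=
  ⟨fun h => Finsupp.ext fun a => h a fun ha => (hK.isCoatom_facet a).1 (top_le_iff.1 ha),
    fun h => h ▸ .refl _ _⟩

theorem agreeOff_facet_iff (hK : IsPolytope n rk) {a : Facet n rk} {x y : Coord n rk} :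
    AgreeOff a.1 x y ↔ y = x ∨ y = x + Finsupp.single a 1 := by
  refine ⟨fun h => ?_, ?_⟩
  · induction h using AgreeOff.induction_on with
    | hx => exact Or.inl rfl
    | hstep z b hab _ ih =>
      obtain rfl := hK.facet_le_iff_eq.1 hab
      rcases ih with rfl | rfl
      · exact Or.inr rfl
      · refine Or.inl ?_
        rw [add_assoc, ← Finsupp.single_add, CharTwo.add_self_eq_zero, Finsupp.single_zero,
          add_zero]
  · rintro (rfl | rfl)
    · exact .refl _ _
    · exact .add_single le_rfl _ _

namespace Extension

theorem facetEmb_top_injective (hK : IsPolytope n rk) :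
    Function.Injective fun y : Coord n rk => facetEmb y ⊤ := fun _ _ h =>
  (agreeOff_top_iff hK).1 (facetEmb_eq_facetEmb_iff.1 h).2

theorem isFacetEmbedding_facetEmb (hK : IsPolytope n rk) (y : Coord n rk) :
    IsFacetEmbedding (facetEmb y : K ↪o Extension n rk) where
  isCoatom_top := by
    refine ⟨facetEmb_ne_top y ⊤, fun t ht => by_contra fun htop => ht.ne ?_⟩
    obtain ⟨x, F, rfl⟩ := exists_facetEmb_eq htop
    obtain ⟨hF, hyx⟩ := facetEmb_le_facetEmb_iff.1 ht.le
    rw [top_le_iff.1 hF, (agreeOff_top_iff hK).1 hyx]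
  isLowerSet_range := isLowerSet_range_facetEmb y

theorem exists_facetEmb_top_eq_of_isCoatom {c : Extension n rk} (hc : IsCoatom c) :
    ∃ y, facetEmb y ⊤ = c := by
  obtain ⟨y, F, rfl⟩ := exists_facetEmb_eq hc.1
  exact ⟨y, (hc.le_iff_eq (facetEmb_ne_top y ⊤)).1 ((facetEmb y).monotone le_top)⟩

theorem rank_strictMono (hK : IsPolytope n rk) : StrictMono (rank : Extension n rk → ℤ) := by
  intro s t hst
  obtain ⟨x, F, rfl⟩ := exists_facetEmb_eq hst.ne_top
  rcases eq_or_ne t ⊤ with rfl | ht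
  · exact Int.lt_add_one_of_le (hK.rank_le F)
  · obtain ⟨y, G, rfl⟩ := exists_facetEmb_eq ht
    obtain ⟨hFG, hxy⟩ := facetEmb_le_facetEmb_iff.1 hst.le
    exact hK.rank_strictMono (hFG.lt_of_ne fun he =>
      hst.ne (facetEmb_eq_facetEmb_iff.2 ⟨he, hxy⟩))

theorem rank_le (hK : IsPolytope n rk) (t : Extension n rk) : rank t ≤ n + 1 :=
  (rank_strictMono hK).monotone le_top

theorem range_rank (hK : IsPolytope n rk) :
    Set.range (rank : Extension n rk → ℤ) = Set.Icc (-1 : ℤ) (n + 1 : ℕ) := by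
  ext j
  rw [Set.mem_Icc]
  push_cast
  constructor
  · rintro ⟨t, rfl⟩
    refine ⟨?_, rank_le hK t⟩
    have := (rank_strictMono hK).monotone (bot_le : ⊥ ≤ t)
    exact hK.rank_bot.ge.trans this
  · rintro ⟨h₁, h₂⟩
    rcases h₂.eq_or_lt with rfl | h₂
    · exact ⟨⊤, rfl⟩
    · obtain ⟨F, rfl⟩ : j ∈ Set.range rk := hK.rank_range ▸ ⟨h₁, Int.le_of_lt_add_one h₂⟩
      exact ⟨facetEmb 0 F, rfl⟩

theorem exists_extendFlag_eq (hK : IsPolytope n rk) (Θ : Flag (Extension n rk)) :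
    ∃ y Ψ, (isFacetEmbedding_facetEmb hK y).extendFlag Ψ = Θ :=
  have := wellFoundedGT_of_strictMono_of_le (rank_strictMono hK) (rank_le hK)
  exists_extendFlag_eq_of_cover (isFacetEmbedding_facetEmb hK) (fun _ => exists_facetEmb_eq) Θ

theorem rank_eq_iff (hK : IsPolytope n rk) {t : Extension n rk} :
    rank t = n ↔ ∃ y, facetEmb y ⊤ = t := by
  refine ⟨fun ht => ?_, ?_⟩
  · obtain ⟨y, F, rfl⟩ := exists_facetEmb_eq (t := t) (by rintro rfl; simp [rank_top] at ht)
    refine ⟨y, congrArg _ (by_contra fun hF => ?_)⟩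
    exact (hK.rank_strictMono (Ne.lt_top' hF)).ne (hK.rank_top ▸ ht)
  · rintro ⟨y, rfl⟩
    exact hK.rank_top

theorem facets_above (hK : IsPolytope n rk) (x : Coord n rk) (a : Facet n rk) :
    {t : Extension n rk | rank t = n ∧ facetEmb x a.1 < t ∧ t < ⊤} =
      {facetEmb x ⊤, facetEmb (x + Finsupp.single a 1) ⊤} := by
  have hlt : ∀ z : Coord n rk, facetEmb x a.1 < facetEmb z ⊤ ↔ AgreeOff a.1 x z := fun z =>
    ⟨fun h => (facetEmb_le_facetEmb_iff.1 h.le).2, fun h =>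
      (facetEmb_le_facetEmb_iff.2 ⟨le_top, h⟩).lt_of_ne fun he =>
        (hK.isCoatom_facet a).1 (facetEmb_eq_facetEmb_iff.1 he).1⟩
  ext t
  simp only [rank_eq_iff hK, Set.mem_ofPred_eq, Set.mem_insert_iff, Set.mem_singleton_iff]
  constructor
  · rintro ⟨⟨z, rfl⟩, hz, -⟩
    exact ((agreeOff_facet_iff hK).1 ((hlt z).1 hz)).imp (congrArg (facetEmb · ⊤))
      (congrArg (facetEmb · ⊤))
  · rintro (rfl | rfl)
    · exact ⟨⟨_, rfl⟩, (hlt _).2 (.refl _ _), WithTop.coe_lt_top _⟩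
    · exact ⟨⟨_, rfl⟩, (hlt _).2 (.add_single le_rfl _ _), WithTop.coe_lt_top _⟩

theorem diamond (hK : IsPolytope n rk) (s t : Extension n rk) (j : ℤ) (hst : s < t)
    (hs : rank s = j - 1) (ht : rank t = j + 1) :
    {H : Extension n rk | rank H = j ∧ s < H ∧ H < t}.encard = 2 := by
  rcases eq_or_ne t ⊤ with rfl | hne
  · obtain ⟨x, F, rfl⟩ := exists_facetEmb_eq hst.ne_top
    obtain rfl : j = n := by rw [rank_top] at ht; omega
    rw [facets_above hK x ⟨F, hs⟩, Set.encard_pair]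
    refine (facetEmb_top_injective hK).ne fun h => ?_
    simp at h
  · obtain ⟨y, G, rfl⟩ := exists_facetEmb_eq hne
    obtain ⟨F, rfl⟩ := isLowerSet_range_facetEmb y hst.le ⟨G, rfl⟩
    rw [faces_between_facetEmb, (facetEmb y).injective.encard_image]
    exact hK.diamond F G j ((facetEmb y).lt_iff_lt.1 hst) hs ht

theorem exists_flagAdj_add_single (hK : IsPolytope n rk) {F : K} {t : Extension n rk}
    {y : Coord n rk} {a : Facet n rk} (hF : F ≤ a.1) (hy : facetEmb y F = t)
    (hy' : facetEmb (y + Finsupp.single a 1) F = t) :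
    ∃ Ψ j, FlagAdj (fun s : Set.Ici t => rank s.1) j
      (((isFacetEmbedding_facetEmb hK y).iciEmbedding hy).extendFlag Ψ)
      (((isFacetEmbedding_facetEmb hK _).iciEmbedding hy').extendFlag Ψ) := by
  obtain ⟨Ψ, hΨ⟩ := Flag.exists_mem (⟨a.1, hF⟩ : Set.Ici F)
  refine ⟨Ψ, n, flagAdj_extendFlag_of_agree _ _ hK.rank_top hK.rank_top (fun h => ?_)
    fun s hs hne => Subtype.ext (facetEmb_eq_facetEmb_iff.2 ⟨rfl, .add_single ?_ _ _⟩)⟩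
  · have := facetEmb_top_injective hK (congrArg Subtype.val h)
    simp at this
  · exact le_isCoatom_of_comparable (hK.isCoatom_facet a) (fun h => hne (Subtype.ext h))
      (Ψ.le_or_le hs hΨ)

theorem flagGraph_ici_connected (hK : IsPolytope n rk) (x : Coord n rk) (F : K) :
    (flagGraph fun s : Set.Ici (facetEmb x F) => rank s.1).Connected := by
  have : WellFoundedGT (Extension n rk) :=
    wellFoundedGT_of_strictMono_of_le (rank_strictMono hK) (rank_le hK)
  have : Nontrivial (Set.Ici (facetEmb x F)) :=
    ⟨⟨_, Set.self_mem_Ici⟩, ⊤, fun h => facetEmb_ne_top x F (congrArg Subtype.val h)⟩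
  refine flagGraph_connected_of_cover
    (φ := fun y : {y : Coord n rk // facetEmb y F = facetEmb x F} =>
      iciEmbedding (facetEmb y.1) y.2)
    (r' := fun s => rk s.1)
    (fun y => (isFacetEmbedding_facetEmb hK y.1).iciEmbedding y.2) ?_ (fun _ _ => rfl) ?_ ?_
  · rintro ⟨t, ht⟩ hne
    obtain ⟨y, G, rfl⟩ := exists_facetEmb_eq fun h => hne (Subtype.ext h)
    obtain ⟨hFG, hxy⟩ := facetEmb_le_facetEmb_iff.1 ht
    exact ⟨⟨y, facetEmb_eq_facetEmb_iff.2 ⟨rfl, hxy.symm⟩⟩, ⟨G, hFG⟩, rfl⟩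
  · exact (flagGraph_connected_congr (OrderIso.setCongr _ _ Set.Icc_top) fun _ => rfl).1
      (hK.connected F ⊤ le_top)
  · rintro ⟨y, hy⟩ ⟨y', hy'⟩
    have hyy' : AgreeOff F y y' := (facetEmb_eq_facetEmb_iff.1 (hy.trans hy'.symm)).2
    induction hyy' using AgreeOff.induction_on with
    | hx => exact .refl
    | hstep z a hFa hz ih =>
      have hzx : facetEmb z F = facetEmb x F :=
        (facetEmb_eq_facetEmb_iff.2 ⟨rfl, hz.symm⟩).trans hy
      exact (ih hzx).tail (exists_flagAdj_add_single hK hFa hzx hy')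

theorem flagGraph_icc_connected (hK : IsPolytope n rk) {s t : Extension n rk} (hst : s ≤ t) :
    (flagGraph fun H : Set.Icc s t => rank H.1).Connected := by
  rcases eq_or_ne t ⊤ with rfl | ht
  · rcases eq_or_ne s ⊤ with rfl | hs
    · have : Subsingleton (Set.Icc (⊤ : Extension n rk) ⊤) :=
        (Set.subsingleton_Icc_of_ge le_rfl).coe_sort
      exact flagGraph_connected_of_subsingleton _
    · obtain ⟨x, F, rfl⟩ := exists_facetEmb_eq hs
      exact (flagGraph_connected_congr (OrderIso.setCongr _ _ Set.Icc_top) fun _ => rfl).2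
        (flagGraph_ici_connected hK x F)
  · obtain ⟨y, G, rfl⟩ := exists_facetEmb_eq ht
    obtain ⟨F, rfl⟩ := isLowerSet_range_facetEmb y hst ⟨G, rfl⟩
    exact (flagGraph_connected_congr ((isFacetEmbedding_facetEmb hK y).sectionIso F G)
      fun _ => rfl).1 (hK.connected F G ((facetEmb y).le_iff_le.1 hst))

theorem isPolytope (hK : IsPolytope n rk) :
    IsPolytope (n + 1) (rank : Extension n rk → ℤ) where
  rank_strictMono := rank_strictMono hK
  rank_range := range_rank hK
  flag_card Θ := by
    obtain ⟨y, Ψ, rfl⟩ := exists_extendFlag_eq hK Θ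
    rw [IsFacetEmbedding.encard_extendFlag, hK.flag_card]
    push_cast
    ring
  diamond := diamond hK
  connected _ _ := flagGraph_icc_connected hK

theorem nonempty_facet_orderIso (hK : IsPolytope n rk)
    (c : Facet (n + 1) (rank : Extension n rk → ℤ)) :
    Nonempty (Set.Icc (⊥ : Extension n rk) c.1 ≃o K) := by
  obtain ⟨y, hy⟩ := exists_facetEmb_top_eq_of_isCoatom ((isPolytope hK).isCoatom_facet c)
  rw [Set.Icc_bot, ← hy]
  exact ⟨(isFacetEmbedding_facetEmb hK y).iicIso.symm⟩

end Extension

end Polytope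

section Groups

theorem orderOf_inr_mul_inl_eq_four {N G : Type*} [Group N] [Group G] {φ : G →* MulAut N} {σ : G}
    {e : N} (hσ : σ * σ = 1) (he : orderOf (φ σ e * e) = 2) :
    orderOf (SemidirectProduct.inr σ * SemidirectProduct.inl e : N ⋊[φ] G) = 4 := by
  have hφσ : φ σ (φ σ e) = e := by
    rw [← MulAut.mul_apply, ← map_mul, hσ, map_one, MulAut.one_apply]
  have hsq : (SemidirectProduct.inr σ * SemidirectProduct.inl e : N ⋊[φ] G) ^ 2 =
      SemidirectProduct.inl (φ σ e * e) := by
    rw [pow_two]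
    ext <;> simp [hφσ, hσ]
  obtain ⟨hd, hd'⟩ := orderOf_eq_prime_iff.1 he
  refine orderOf_eq_prime_pow (p := 2) (n := 1) ?_ ?_
  · rw [pow_one, hsq]
    exact (map_ne_one_iff _ SemidirectProduct.inl_injective).2 hd'
  · rw [pow_succ, pow_mul, pow_one, hsq, ← map_pow, hd, map_one]

theorem period_map {G H : Type u} [Group G] [Group H] {f : G →* H} (hf : Function.Injective f)
    (g : G) : period (f g) = period g := by
  rw [period, period, orderOf_injective f hf]

theorem card_C2Pow (A : Type u) [Finite A] : Nat.card (C2Pow A) = 2 ^ Nat.card A := by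
  rw [Nat.card_congr (Multiplicative.toAdd.trans Finsupp.equivFunOnFinite), Nat.card_fun,
    Nat.card_zmod]

end Groups

section Action

variable {K : Type u} [PartialOrder K] [BoundedOrder K] {n : ℕ} {rk : K → ℤ}

/-- The group `N ⋊ Γ(K)`. -/
abbrev ExtGroup (hK : IsPolytope n rk) : Type u :=
  C2Pow (Facet n rk) ⋊[hK.facetAction] (K ≃o K)

/-- The sequence, as an element of `N`, that changes just the coordinate at `a`. -/
noncomputable abbrev coordFlip (a : Facet n rk) : C2Pow (Facet n rk) :=
  Multiplicative.ofAdd (Finsupp.single a 1)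

variable (hK : IsPolytope n rk)

/-- The action of `N ⋊ Γ(K)` on the sequences: `N` translates them and `Γ(K)` permutes their
coordinates. -/
noncomputable def affine : ExtGroup hK →* Equiv.Perm (Coord n rk) :=
  MonoidHom.mk'
    (fun g => (Finsupp.domCongr (hK.facetPerm g.right)).toEquiv.trans
      (Equiv.addLeft g.left.toAdd))
    fun g h => by
      ext x a
      exact add_assoc (g.left.toAdd a) _ _

theorem affine_apply (g : ExtGroup hK) (x : Coord n rk) :
    affine hK g x = g.left.toAdd + Finsupp.domCongr (hK.facetPerm g.right) x :=
  rfl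

theorem affine_zero (g : ExtGroup hK) : affine hK g 0 = g.left.toAdd := by
  rw [affine_apply, map_zero, add_zero]

theorem agreeOff_affine_iff (g : ExtGroup hK) {F : K} {x y : Coord n rk} :
    AgreeOff (g.right F) (affine hK g x) (affine hK g y) ↔ AgreeOff F x y := by
  rw [AgreeOff, (hK.facetPerm g.right).surjective.forall]
  refine forall_congr' fun a => imp_congr (not_congr g.right.le_iff_le) ?_
  simp only [affine_apply, Finsupp.add_apply, add_right_inj, Finsupp.domCongr_apply,
    Finsupp.equivMapDomain_apply, Equiv.symm_apply_apply]

/-- The action of `N ⋊ Γ(K)` on representatives of proper faces. -/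
noncomputable def actPreFace (g : ExtGroup hK) : PreFace n rk ≃o PreFace n rk where
  toFun p := ⟨g.right p.face, affine hK g p.coord⟩
  invFun p := ⟨g.right.symm p.face, (affine hK g).symm p.coord⟩
  left_inv p := by simp
  right_inv p := by simp
  map_rel_iff' := and_congr g.right.le_iff_le (agreeOff_affine_iff hK g)

/-- Order isomorphisms of preorders pass to the associated partial orders. -/
def antisymmetrizationCongr {α β : Type*} [Preorder α] [Preorder β] (e : α ≃o β) :
    Antisymmetrization α (· ≤ ·) ≃o Antisymmetrization β (· ≤ ·) :=
  OrderIso.ofHomInv (OrderHomClass.toOrderHom e).antisymmetrization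
    (OrderHomClass.toOrderHom e.symm).antisymmetrization
    (OrderHom.ext _ _ <| funext <| Quotient.ind fun b =>
      congrArg (toAntisymmetrization _) (e.apply_symm_apply b))
    (OrderHom.ext _ _ <| funext <| Quotient.ind fun a =>
      congrArg (toAntisymmetrization _) (e.symm_apply_apply a))

namespace Extension

/-- The action of `N ⋊ Γ(K)` on the extension. -/
noncomputable def act : ExtGroup hK →* (Extension n rk ≃o Extension n rk) :=
  MonoidHom.mk' (fun g => (antisymmetrizationCongr (actPreFace hK g)).withTopCongr) fun g h => by
    ext t
    rcases eq_or_ne t ⊤ with rfl | ht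
    · rfl
    · obtain ⟨x, F, rfl⟩ := exists_facetEmb_eq ht
      exact congrArg (fun y : Coord n rk => facetEmb y (g.right (h.right F)))
        (DFunLike.congr_fun (map_mul (affine hK) g h) x)

theorem act_facetEmb (g : ExtGroup hK) (x : Coord n rk) (F : K) :
    act hK g (facetEmb x F) = facetEmb (affine hK g x) (g.right F) :=
  rfl

theorem act_smul_extendFlag (g : ExtGroup hK) (x : Coord n rk) (Ψ : Flag K) :
    act hK g • (isFacetEmbedding_facetEmb hK x).extendFlag Ψ =
      (isFacetEmbedding_facetEmb hK (affine hK g x)).extendFlag (g.right • Ψ) := by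
  refine flag_eq_of_le ?_
  rintro _ ⟨t, rfl | ⟨F, hF, rfl⟩, rfl⟩
  · exact Or.inl (map_top (act hK g))
  · exact Or.inr ⟨g.right F, ⟨F, hF, rfl⟩, (act_facetEmb hK g x F).symm⟩

theorem act_injective : Function.Injective (act hK) := by
  refine (injective_iff_map_eq_one _).2 fun g hg => ?_
  have hfix : ∀ F, facetEmb g.left.toAdd (g.right F) = (facetEmb 0 F : Extension n rk) :=
    fun F => by
      rw [← affine_zero, ← act_facetEmb, hg]
      rfl
  have htop := hfix ⊤
  rw [map_top] at htop
  exact SemidirectProduct.ext (facetEmb_top_injective hK htop)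
    (RelIso.ext fun F => (facetEmb_eq_facetEmb_iff.1 (hfix F)).1)

theorem act_surjective : Function.Surjective (act hK) := fun τ => by
  obtain ⟨y, hy⟩ := exists_facetEmb_top_eq_of_isCoatom
    ((τ.isCoatom_iff _).2 (isFacetEmbedding_facetEmb hK 0).isCoatom_top)
  obtain ⟨σ, hσ⟩ := (isFacetEmbedding_facetEmb hK 0).exists_orderIso_of_map_top
    (isFacetEmbedding_facetEmb hK y) hy.symm
  obtain ⟨Ψ⟩ : Nonempty (Flag K) := inferInstance
  refine ⟨⟨Multiplicative.ofAdd y, σ⟩, (isPolytope hK).eq_of_smul_eq_smul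
    (Φ := (isFacetEmbedding_facetEmb hK 0).extendFlag Ψ) (flag_eq_of_le ?_)⟩
  rintro _ ⟨t, rfl | ⟨F, hF, rfl⟩, rfl⟩
  · exact mem_flag_smul_iff.2 (Or.inl (map_top _))
  · refine ⟨facetEmb 0 F, Or.inr ⟨F, hF, rfl⟩, ?_⟩
    exact (hσ F).symm.trans (congrArg (facetEmb · (σ F)) (affine_zero hK ⟨_, σ⟩).symm)

/-- Every automorphism of the extension comes from `N ⋊ Γ(K)`. -/
noncomputable def autEquiv : (Extension n rk ≃o Extension n rk) ≃* ExtGroup hK :=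
  (MulEquiv.ofBijective _ ⟨act_injective hK, act_surjective hK⟩).symm

include hK in
theorem card_aut [Finite K] : Nat.card (Extension n rk ≃o Extension n rk) =
    Nat.card (K ≃o K) * 2 ^ Nat.card (Facet n rk) := by
  rw [Nat.card_congr (autEquiv hK).toEquiv, SemidirectProduct.card, card_C2Pow, mul_comm]

theorem isRegularPolytope (hK : IsRegularPolytope n rk) :
    IsRegularPolytope (n + 1) (rank : Extension n rk → ℤ) where
  toIsPolytope := isPolytope hK.toIsPolytope
  flag_transitive Θ Θ' := by
    obtain ⟨x, Ψ, rfl⟩ := exists_extendFlag_eq hK.toIsPolytope Θ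
    obtain ⟨y, Ψ', rfl⟩ := exists_extendFlag_eq hK.toIsPolytope Θ'
    obtain ⟨σ, rfl⟩ := hK.flag_transitive Ψ Ψ'
    let g : ExtGroup hK.toIsPolytope :=
      ⟨Multiplicative.ofAdd (y - Finsupp.domCongr (hK.facetPerm σ) x), σ⟩
    have hgx : affine hK.toIsPolytope g x = y := sub_add_cancel _ _
    refine ⟨act hK.toIsPolytope g, ?_⟩
    rw [act_smul_extendFlag]
    simp only [hgx]
    rfl

end Extension

end Action

section SchlafliType

variable {K : Type u} [PartialOrder K] [BoundedOrder K] {n : ℕ} {rk : K → ℤ}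

/-- The generators of the extension: those of `K`, followed by the change of the coordinate at the
base facet `a`. -/
noncomputable def generator (hK : IsPolytope n rk) (ρ : ℕ → (K ≃o K)) (a : Facet n rk) (j : ℕ) :
    ExtGroup hK :=
  if j < n then SemidirectProduct.inr (ρ j)
  else SemidirectProduct.inl (coordFlip a)

variable (hK : IsPolytope n rk) {ρ : ℕ → (K ≃o K)} {a : Facet n rk} {j : ℕ}

theorem generator_of_lt (hj : j < n) : generator hK ρ a j = SemidirectProduct.inr (ρ j) :=
  if_pos hj

theorem generator_self : generator hK ρ a n = SemidirectProduct.inl (coordFlip a) :=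
  if_neg (lt_irrefl n)

theorem orderOf_facetAction_coordFlip_mul_coordFlip {σ : K ≃o K} (hσ : hK.facetPerm σ a ≠ a) :
    orderOf (hK.facetAction σ (coordFlip a) * coordFlip a) = 2 := by
  refine orderOf_eq_prime ?_ fun h => ?_
  · rw [pow_two]
    exact Finsupp.ext fun b => CharTwo.add_self_eq_zero (R := ZMod 2) _
  · have hsum : (Finsupp.single (hK.facetPerm σ a) 1 + Finsupp.single a 1 : Coord n rk) = 0 := by
      rw [← Finsupp.equivMapDomain_single]
      exact h
    simpa [hσ] using DFunLike.congr_fun hsum a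

theorem orderOf_generator_mul_generator {Φ : Flag K} (ha : a.1 ∈ Φ) (hj : j + 1 = n)
    (hadj : FlagAdj rk j Φ (ρ j • Φ)) :
    orderOf (generator hK ρ a j * generator hK ρ a n) = 4 := by
  rw [generator_of_lt hK (by omega), generator_self]
  refine orderOf_inr_mul_inl_eq_four (hK.mul_self_eq_one_of_flagAdj hadj)
    (orderOf_facetAction_coordFlip_mul_coordFlip hK fun h => ?_)
  exact hK.map_ne_of_flagAdj hadj ha (by rw [a.2]; omega) (congrArg Subtype.val h)

namespace Extension

theorem flagAdj_generator {Φ : Flag K} (ha : a.1 ∈ Φ)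
    (hadj : ∀ j < n, FlagAdj rk j Φ (ρ j • Φ)) (hj : j < n + 1) :
    FlagAdj (rank : Extension n rk → ℤ) j ((isFacetEmbedding_facetEmb hK 0).extendFlag Φ)
      (act hK (generator hK ρ a j) • (isFacetEmbedding_facetEmb hK 0).extendFlag Φ) := by
  simp only [act_smul_extendFlag, affine_zero]
  rcases (Nat.lt_succ_iff.1 hj).lt_or_eq with hj | rfl
  · rw [generator_of_lt hK hj]
    exact (hadj j hj).extendFlag _ fun _ => rfl
  · rw [generator_self, SemidirectProduct.right_inl, one_smul]
    refine flagAdj_extendFlag_of_agree _ _ hK.rank_top hK.rank_top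
      ((facetEmb_top_injective hK).ne fun h => ?_) fun s hs hst =>
        facetEmb_eq_facetEmb_iff.2 ⟨rfl, ?_⟩
    · simpa using DFunLike.congr_fun h a
    · have hsa := le_isCoatom_of_comparable (hK.isCoatom_facet a) hst (Φ.le_or_le hs ha)
      rw [← zero_add (Multiplicative.toAdd _)]
      exact .add_single hsa 0 1

include hK in
theorem hasSchlafliType {p : ℕ → ℕ∞} (hp : HasSchlafliType n rk p) :
    HasSchlafliType (n + 1) (rank : Extension n rk → ℤ) fun j => if j = n then 4 else p j := by
  obtain ⟨Φ, ρ, hadj, hper⟩ := hp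
  obtain ⟨F, hF, hFr⟩ := hK.exists_mem_flag Φ (j := (n : ℤ) - 1) (by omega) (by omega)
  refine ⟨_, fun j => act hK (generator hK ρ ⟨F, hFr⟩ j),
    fun j hj => flagAdj_generator hK hF hadj hj, fun j hj hjn => ?_⟩
  rw [← map_mul, period_map (act_injective hK)]
  rcases (Nat.lt_succ_iff.1 hjn).lt_or_eq with hjn | rfl
  · rw [generator_of_lt hK hjn, generator_of_lt hK (by omega), ← map_mul,
      period_map SemidirectProduct.inr_injective, hper j hj hjn]
    exact (if_neg hjn.ne).symm
  · rw [period, orderOf_generator_mul_generator hK hF (Nat.sub_add_cancel hj)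
      (hadj _ (Nat.sub_lt hj one_pos)), if_neg four_ne_zero]
    exact (if_pos rfl).symm

end Extension

end SchlafliType

end AbsPoly

theorem lemma3p1_general (m : ℕ) {K : Type u} [PartialOrder K] [BoundedOrder K] (rk : K → ℤ)
    (hK : AbsPoly.IsPolytope m rk) :
    ∃ (L : Type u) (_ : PartialOrder L) (_ : BoundedOrder L) (rkL : L → ℤ),
      AbsPoly.IsPolytope (m + 1) rkL ∧
      (AbsPoly.IsRegularPolytope m rk → AbsPoly.IsRegularPolytope (m + 1) rkL) ∧
      (∀ p, AbsPoly.HasSchlafliType m rk p →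
        AbsPoly.HasSchlafliType (m + 1) rkL (fun j => if j = m then 4 else p j)) ∧
      (∀ F : AbsPoly.Facet (m + 1) rkL, Nonempty (Set.Icc (⊥ : L) F.1 ≃o K)) ∧
      Nonempty ((L ≃o L) ≃*
        AbsPoly.C2Pow (AbsPoly.Facet m rk) ⋊[hK.facetAction] (K ≃o K)) ∧
      (Finite K →
        Nat.card (L ≃o L) = Nat.card (K ≃o K) * 2 ^ Nat.card (AbsPoly.Facet m rk)) ∧
      (Finite L ↔ Finite K) :=
  ⟨AbsPoly.Extension m rk, inferInstance, inferInstance, AbsPoly.Extension.rank,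
    AbsPoly.Extension.isPolytope hK, AbsPoly.Extension.isRegularPolytope,
    fun _ => AbsPoly.Extension.hasSchlafliType hK, AbsPoly.Extension.nonempty_facet_orderIso hK,
    ⟨AbsPoly.Extension.autEquiv hK⟩, fun _ => AbsPoly.Extension.card_aut hK,
    AbsPoly.Extension.finite_iff⟩

theorem lemma3p1 (m : ℕ) {K : Type u} [PartialOrder K] [BoundedOrder K] (rk : K → ℤ)
    (hK : AbsPoly.IsRegularPolytope m rk) (p : ℕ → ℕ∞)
    (hp : AbsPoly.HasSchlafliType m rk p) :
    ∃ (L : Type u) (_ : PartialOrder L) (_ : BoundedOrder L) (rkL : L → ℤ),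
      AbsPoly.IsRegularPolytope (m + 1) rkL ∧
      AbsPoly.HasSchlafliType (m + 1) rkL (fun j => if j = m then 4 else p j) ∧
      (∀ F : AbsPoly.Facet (m + 1) rkL, Nonempty (Set.Icc (⊥ : L) F.1 ≃o K)) ∧
      Nonempty ((L ≃o L) ≃*
        AbsPoly.C2Pow (AbsPoly.Facet m rk) ⋊[hK.toIsPolytope.facetAction] (K ≃o K)) ∧
      (Finite K →
        Nat.card (L ≃o L) = Nat.card (K ≃o K) * 2 ^ Nat.card (AbsPoly.Facet m rk)) ∧
      (Finite L ↔ Finite K) := by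
  obtain ⟨L, _, _, rkL, -, hreg, htype, hL⟩ := lemma3p1_general m rk hK.toIsPolytope
  exact ⟨L, _, _, rkL, hreg hK, htype p hp, hL⟩
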